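/- An oriented graph $\widetilde G=(G,\tilde\sigma)$ is a finite simple graph $G=(V,E)$ together with a map $\tilde\sigma:E\to V$ with $\tilde\sigma(ij)\in\{i,j\}$ for every edge $ij\in E$. Its skew-adjacency matrix $S(\widetilde G)=(\tilde s_{ij})$ is the real $V\times V$ matrix with $\tilde s_{ij}=0$ if $ij\notin E$, $\tilde s_{ij}=1$ if $ij\in E$ and $\tilde\sigma(ij)=i$, and $\tilde s_{ij}=-1$ if $ij\in E$ and $\tilde\sigma(ij)=j$; its $S$-spectral radius $\rho_S(\widetilde G)$ is the largest modulus of a complex eigenvalue of $S(\widetilde G)$. A caterpillar is a tree such that the removal of all its pendant vertices (the vertices of degree $1$) results in a (possibly empty) path; an oriented caterpillar is an oriented graph whose underlying graph is a caterpillar. **Proposition.** For every real number $\lambda\ge\sqrt{2+\sqrt5}$ there exists a sequence $(\widetilde T_k)_{k\in\mathbb N}$ of oriented caterpillars such that $\rho_S(\widetilde T_i)\ne\rho_S(\widetilde T_j)$ whenever $i\ne j$, and $$\lim_{k\to\infty}\rho_S(\widetilde T_k)=\lambda .$$ In other words, $\lambda$ is a limit point of the $S$-spectral radii of oriented caterpillars.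 -/

import Mathlib

open Filter Topology

/-- An oriented graph on the vertex set `V`: a simple graph together with an edge orientation,
that is, a map choosing for every edge one of its two ends, the vertex it points to. -/
structure OrientedGraph (V : Type*) where
  /-- the underlying simple graph -/
  graph : SimpleGraph V
  /-- the end to which an edge points -/
  head : graph.edgeSet → V
  head_mem : ∀ e : graph.edgeSet, head e ∈ (e : Sym2 V)

namespace OrientedGraph

variable {V : Type*}

open Classical in
/-- The skew-adjacency matrix: the entry `(i, j)` is `0` if `ij` is not an edge, `1` if the edge
`ij` points to `i`, and `-1` if it points to `j`. -/
noncomputable def skewAdjMatrix (G : OrientedGraph V) : Matrix V V ℝ :=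
  Matrix.of fun i j =>
    if h : G.graph.Adj i j then
      if G.head ⟨s(i, j), h⟩ = i then 1 else -1
    else 0

/-- The skew spectral radius: the largest modulus of a complex eigenvalue of the
skew-adjacency matrix. (The complex spectrum of a finite matrix is finite, so the supremum in
`spectralRadius` is a maximum whenever `V` is finite and non-empty.) -/
noncomputable def skewSpectralRadius [Fintype V] [DecidableEq V] (G : OrientedGraph V) : ℝ :=
  (spectralRadius ℂ (G.skewAdjMatrix.map (fun x : ℝ => (x : ℂ)))).toReal

end OrientedGraph

/-- A caterpillar: a tree such that the removal of all pendant vertices (the vertices with exactly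
one neighbour) results in a path, which is automatically chordless. The path is empty only for the
tree with two vertices. -/
def SimpleGraph.IsCaterpillar {V : Type*} (G : SimpleGraph V) : Prop :=
  G.IsTree ∧
    ∃ m : ℕ, Nonempty (G.induce {v : V | (G.neighborSet v).ncard ≠ 1} ≃g SimpleGraph.pathGraph m)

/-! Orienting a bipartite graph towards one colour class makes `S` the adjacency matrix `A` up to
row signs. So a Rayleigh quotient of `A` bounds the radius below, while a positive `y` with `A y ≤ c
y` bounds it above.

Fix `lam > √(2 + √5)` and let `t < 1` be the smaller root of `t² + 1 = lam t`. Build a positive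
vector along a spine, with value `x i / lam` on each leaf at `i` and just enough leaves to keep
every ratio `r i = x (i+1) / x i` in `[t, t + 1/lam)`. Cutting the spine at `k` spoils the
eigenvalue equation only there. The form `lam x_i x_{i+1} - x_i² - x_{i+1}²` is preserved by a
leafless step and not increased by leaves (`greedyRatio_field_le`); this uses `t⁴ + t² < 1`, that
is, `lam² > 2 + √5`. Hence `x` is bounded, some `x k ^ 2` is negligible against the sum of squares,
and cutting there gives a radius in `[lam - ε, lam]`.

Doing this for values slightly above the given one yields radii decreasing strictly to it, which
also covers the endpoint. -/

namespace OrientedGraph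

/-! ### Orientations and bounds on the skew spectral radius -/

variable {V : Type*}

/-- The orientation of a properly 2-coloured graph in which every edge points to its
`true` end. -/
noncomputable def ofColoring (G : SimpleGraph V) (c : G.Coloring Bool) : OrientedGraph V where
  graph := G
  head e := if c e.1.out.1 then e.1.out.1 else e.1.out.2
  head_mem e := by
    split_ifs
    · exact Sym2.out_fst_mem _
    · exact Sym2.out_snd_mem _

lemma color_head_ofColoring (G : SimpleGraph V) (c : G.Coloring Bool) (e : G.edgeSet) :
    c ((ofColoring G c).head e) = true := by
  have h : G.Adj e.1.out.1 e.1.out.2 := by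
    have := e.2
    rwa [← Quot.out_eq e.1] at this
  have hne := c.valid h
  simp only [ofColoring]
  split_ifs with h1
  · exact h1
  · revert hne h1
    cases c e.1.out.1 <;> cases c e.1.out.2 <;> simp

open Classical in
lemma skewAdjMatrix_ofColoring (G : SimpleGraph V) (c : G.Coloring Bool) (i j : V) :
    (ofColoring G c).skewAdjMatrix i j =
      (if c i then 1 else -1) * (if G.Adj i j then 1 else 0) := by
  simp only [skewAdjMatrix, Matrix.of_apply]
  by_cases h : G.Adj i j
  · have hh : (ofColoring G c).graph.Adj i j := h
    have hc := color_head_ofColoring G c ⟨s(i, j), h⟩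
    have hm := (ofColoring G c).head_mem ⟨s(i, j), hh⟩
    have hne := c.valid h
    rw [dif_pos hh, if_pos h, mul_one]
    rcases Sym2.mem_iff.1 hm with h1 | h1
    · have : c i = true := by rw [← h1]; exact hc
      simp [h1, this]
    · have h2 : c j = true := by rw [← h1]; exact hc
      have h3 : c i = false := by
        rw [h2] at hne
        simpa using hne
      have h4 : ¬ j = i := fun h5 => h.ne h5.symm
      simp [h1, h3, h4]
  · have hh : ¬ (ofColoring G c).graph.Adj i j := h
    rw [dif_neg hh, if_neg h, mul_zero]

open Classical in
lemma abs_skewAdjMatrix (G : OrientedGraph V) (i j : V) :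
    |G.skewAdjMatrix i j| = if G.graph.Adj i j then 1 else 0 := by
  simp only [skewAdjMatrix, Matrix.of_apply]
  split_ifs <;> simp

lemma skewAdjMatrix_swap (G : OrientedGraph V) (i j : V) :
    G.skewAdjMatrix j i = - G.skewAdjMatrix i j := by
  simp only [skewAdjMatrix, Matrix.of_apply]
  by_cases h : G.graph.Adj i j
  · have hm := G.head_mem ⟨s(i, j), h⟩
    have he : (⟨s(j, i), h.symm⟩ : G.graph.edgeSet) = ⟨s(i, j), h⟩ := Subtype.ext Sym2.eq_swap
    rw [dif_pos h, dif_pos h.symm, he]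
    have hne := h.ne
    rcases Sym2.mem_iff.1 hm with h1 | h1
    · simp [h1, hne]
    · simp [h1, hne.symm]
  · rw [dif_neg h, dif_neg (fun h' => h h'.symm), neg_zero]

variable [Fintype V] [DecidableEq V]

open Classical in
/-- A positive vector `y` with `A y ≤ c y` bounds the skew spectral radius by `c`. -/
lemma skewSpectralRadius_le (G : OrientedGraph V) {c : ℝ} (hc : 0 ≤ c) (y : V → ℝ)
    (hy : ∀ v, 0 < y v) (h : ∀ v, ∑ w, (if G.graph.Adj v w then y w else 0) ≤ c * y v) :
    G.skewSpectralRadius ≤ c := by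
  have key : spectralRadius ℂ (G.skewAdjMatrix.map (fun x : ℝ => (x : ℂ))) ≤ ENNReal.ofReal c := by
    refine iSup₂_le fun μ hμ => ?_
    rw [← Matrix.spectrum_toLin', ← Module.End.hasEigenvalue_iff_mem_spectrum] at hμ
    obtain ⟨z, hz⟩ := hμ.exists_hasEigenvector
    have hz0 := hz.2
    have hzμ : ∀ v, ∑ w, (G.skewAdjMatrix v w : ℂ) * z w = μ * z v := fun v => by
      have := congrFun hz.apply_eq_smul v
      simpa [Matrix.toLin'_apply, Matrix.mulVec, dotProduct] using this
    obtain ⟨v₀, hv₀⟩ : ∃ v, z v ≠ 0 := by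
      by_contra! hcon
      exact hz0 (funext hcon)
    have : Nonempty V := ⟨v₀⟩
    -- Compare the eigenvector with `y` where the ratio is largest; there the eigenvalue equation
    -- forces `‖μ‖ ≤ c`.
    obtain ⟨v, -, hv⟩ := Finset.exists_max_image Finset.univ (fun v => ‖z v‖ / y v)
      ⟨v₀, Finset.mem_univ _⟩
    set t := ‖z v‖ / y v with ht
    have htpos : 0 < t := lt_of_lt_of_le (div_pos (norm_pos_iff.2 hv₀) (hy v₀))
      (hv v₀ (Finset.mem_univ _))
    have hbd : ∀ w, ‖z w‖ ≤ t * y w := fun w =>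
      (div_le_iff₀ (hy w)).1 (hv w (Finset.mem_univ _))
    have hzv : ‖z v‖ = t * y v := by rw [ht, div_mul_cancel₀ _ (hy v).ne']
    have h1 : ‖μ‖ * (t * y v) ≤ c * (t * y v) := by
      calc ‖μ‖ * (t * y v) = ‖∑ w, (G.skewAdjMatrix v w : ℂ) * z w‖ := by
            rw [hzμ v, norm_mul, hzv]
        _ ≤ ∑ w, ‖(G.skewAdjMatrix v w : ℂ) * z w‖ := norm_sum_le _ _
        _ ≤ ∑ w, t * (if G.graph.Adj v w then y w else 0) := by
            refine Finset.sum_le_sum fun w _ => ?_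
            rw [norm_mul, Complex.norm_real, Real.norm_eq_abs, abs_skewAdjMatrix]
            split_ifs
            · rw [one_mul]; exact hbd w
            · simp
        _ ≤ c * (t * y v) := by
            rw [← Finset.mul_sum]
            nlinarith [h v]
    have h2 : ‖μ‖ ≤ c := le_of_mul_le_mul_right h1 (mul_pos htpos (hy v))
    rw [ENNReal.ofReal, ENNReal.coe_le_coe, ← NNReal.coe_le_coe, Real.coe_toNNReal _ hc, coe_nnnorm]
    exact h2
  exact ENNReal.toReal_le_of_le_ofReal hc key

/-- A real skew-symmetric matrix is normal, and the spectral radius of a normal operator is its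
norm. -/
lemma skewSpectralRadius_eq_norm (G : OrientedGraph V) [Nonempty V] :
    G.skewSpectralRadius =
      ‖Matrix.toEuclideanCLM (𝕜 := ℂ) (G.skewAdjMatrix.map (fun x : ℝ => (x : ℂ)))‖ := by
  set S := G.skewAdjMatrix.map (fun x : ℝ => (x : ℂ)) with hS
  have hstar : star S = -S := by
    ext i j
    simp [hS, Matrix.star_apply, G.skewAdjMatrix_swap i j]
  have hn : IsStarNormal (Matrix.toEuclideanCLM (𝕜 := ℂ) S) := by
    refine ⟨?_⟩
    rw [← map_star, hstar, map_neg]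
    exact (Commute.refl (Matrix.toEuclideanCLM (𝕜 := ℂ) S)).neg_left
  have h := IsStarNormal.spectralRadius_eq_nnnorm (Matrix.toEuclideanCLM (𝕜 := ℂ) S)
  rw [spectralRadius, AlgEquiv.spectrum_eq] at h
  rw [skewSpectralRadius, spectralRadius, h]
  simp

open Classical in
/-- For the bipartite orientation the skew spectral radius is at least every Rayleigh quotient of
the adjacency matrix. -/
lemma le_skewSpectralRadius_ofColoring (G : SimpleGraph V) (col : G.Coloring Bool) {c : ℝ}
    (x : V → ℝ) (hx : 0 < ∑ v, x v ^ 2)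
    (h : c * ∑ v, x v ^ 2 ≤ ∑ v, x v * ∑ w, (if G.Adj v w then x w else 0)) :
    c ≤ (ofColoring G col).skewSpectralRadius := by
  have : Nonempty V := by
    by_contra hV
    rw [not_nonempty_iff] at hV
    simp at hx
  rw [skewSpectralRadius_eq_norm]
  set T := Matrix.toEuclideanCLM (𝕜 := ℂ)
    ((ofColoring G col).skewAdjMatrix.map (fun x : ℝ => (x : ℂ))) with hT
  set ax : V → ℝ := fun v => ∑ w, (if G.Adj v w then x w else 0) with hax
  let xc : EuclideanSpace ℂ V := WithLp.toLp 2 fun v => (x v : ℂ)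
  have hnx : ‖xc‖ ^ 2 = ∑ v, x v ^ 2 := by
    simp [xc, EuclideanSpace.norm_sq_eq]
  have hnT : ‖T xc‖ ^ 2 = ∑ v, ax v ^ 2 := by
    rw [EuclideanSpace.norm_sq_eq]
    refine Finset.sum_congr rfl fun v _ => ?_
    have : (T xc) v = (((if col v then 1 else -1) * ax v : ℝ) : ℂ) := by
      simp only [hT, Matrix.ofLp_toEuclideanCLM, xc, Matrix.mulVec, dotProduct, Matrix.map_apply,
        skewAdjMatrix_ofColoring, hax, Finset.mul_sum]
      push_cast
      refine Finset.sum_congr rfl fun w _ => ?_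
      split_ifs <;> simp
    rw [this, Complex.norm_real, Real.norm_eq_abs, sq_abs]
    split_ifs <;> ring
  -- The signs drop out of `‖T xc‖`, so Cauchy–Schwarz gives `c ‖x‖² ≤ ⟨x, A x⟩ ≤ ‖x‖ ‖T x‖`.
  have hcs : (∑ v, x v * ax v) ^ 2 ≤ (∑ v, x v ^ 2) * ∑ v, ax v ^ 2 :=
    Finset.sum_mul_sq_le_sq_mul_sq _ _ _
  have hop := T.le_opNorm xc
  rw [← hnx, ← hnT, ← mul_pow] at hcs
  have h1 := abs_le_of_sq_le_sq hcs (by positivity)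
  have h2 : c * ‖xc‖ ^ 2 ≤ ‖xc‖ * ‖T xc‖ := by rw [hnx]; exact h.trans (le_of_abs_le h1)
  rw [← hnx] at hx
  have h3 : c * ‖xc‖ ^ 2 ≤ ‖T‖ * ‖xc‖ ^ 2 := by nlinarith [norm_nonneg xc]
  exact le_of_mul_le_mul_right h3 hx

end OrientedGraph

/-! ### Trees and caterpillars -/

namespace SimpleGraph

variable {V W : Type*}

/-- Each edge joins some `v ≠ r` to `par v`, so there are at most `|V| - 1` edges. -/
lemma Connected.isTree_of_parent [Finite V] {G : SimpleGraph V} (hG : G.Connected) (r : V)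
    (par : V → V)
    (h : ∀ u v, G.Adj u v → (u ≠ r ∧ par u = v) ∨ (v ≠ r ∧ par v = u)) : G.IsTree := by
  classical
  have := Fintype.ofFinite V
  refine isTree_iff_connected_and_card.2 ⟨hG, le_antisymm ?_ hG.card_vert_le_card_edgeSet_add_one⟩
  have hsub : G.edgeSet ⊆ ((Finset.univ.erase r).image fun v => s(v, par v) : Finset (Sym2 V)) := by
    intro e
    induction e using Sym2.ind with
    | _ u v =>
      intro he
      rw [Finset.mem_coe, Finset.mem_image]
      rcases h u v he with ⟨h1, h2⟩ | ⟨h1, h2⟩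
      · exact ⟨u, by simp [h1], by rw [h2]⟩
      · exact ⟨v, by simp [h1], by rw [h2, Sym2.eq_swap]⟩
  have h1 := Set.ncard_le_ncard hsub
  rw [Set.ncard_coe_finset] at h1
  have h2 : (Finset.univ.erase r).card + 1 = Nat.card V := by
    rw [Finset.card_erase_add_one (Finset.mem_univ r), Finset.card_univ, Nat.card_eq_fintype_card]
  rw [← h2]
  exact Nat.add_le_add_right (h1.trans Finset.card_image_le) 1

lemma IsCaterpillar.of_iso {G : SimpleGraph V} {H : SimpleGraph W} (f : G ≃g H)
    (hH : H.IsCaterpillar) : G.IsCaterpillar := by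
  obtain ⟨htree, m, ⟨g⟩⟩ := hH
  refine ⟨f.isTree_iff.2 htree, m, ⟨?_⟩⟩
  have hn : ∀ v, (G.neighborSet v).ncard = (H.neighborSet (f v)).ncard := fun v =>
    Nat.card_congr (f.mapNeighborSet v)
  exact g.comp
    { toEquiv := f.toEquiv.subtypeEquiv fun v => not_congr (by rw [hn v]; rfl)
      map_rel_iff' := fun {a b} => f.map_adj_iff }

/-- The caterpillar with spine `0, …, m - 1` and `p i` pendant vertices attached to `i`. -/
def caterpillar (m : ℕ) (p : ℕ → ℕ) : SimpleGraph (Fin m ⊕ Σ i : Fin m, Fin (p i)) where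
  Adj
    | .inl i, .inl j => (pathGraph m).Adj i j
    | .inl i, .inr l => l.1 = i
    | .inr l, .inl i => l.1 = i
    | .inr _, .inr _ => False
  symm := ⟨by
    rintro (i | l) (j | l') h
    · exact Adj.symm h
    · exact h
    · exact h
    · exact h⟩
  loopless := ⟨by
    rintro (i | l) h
    · exact Adj.ne h rfl
    · exact h⟩

section caterpillar
variable {m : ℕ} {p : ℕ → ℕ}

@[simp] lemma caterpillar_adj_inl_inl (i j : Fin m) :
    (caterpillar m p).Adj (.inl i) (.inl j) ↔ i.val + 1 = j.val ∨ j.val + 1 = i.val :=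
  pathGraph_adj

@[simp] lemma caterpillar_adj_inl_inr (i : Fin m) (l : Σ i : Fin m, Fin (p i)) :
    (caterpillar m p).Adj (.inl i) (.inr l) ↔ l.1 = i := Iff.rfl

@[simp] lemma caterpillar_adj_inr_inl (i : Fin m) (l : Σ i : Fin m, Fin (p i)) :
    (caterpillar m p).Adj (.inr l) (.inl i) ↔ l.1 = i := Iff.rfl

@[simp] lemma caterpillar_adj_inr_inr (l l' : Σ i : Fin m, Fin (p i)) :
    ¬ (caterpillar m p).Adj (.inr l) (.inr l') := fun h => h

lemma caterpillar_connected (k : ℕ) (p : ℕ → ℕ) : (caterpillar (k + 1) p).Connected := by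
  rw [connected_iff_exists_forall_reachable]
  let f : pathGraph (k + 1) →g caterpillar (k + 1) p := ⟨Sum.inl, fun h => h⟩
  have hs : ∀ i, (caterpillar (k + 1) p).Reachable (.inl 0) (.inl i) := fun i =>
    ((pathGraph_connected k).preconnected 0 i).map f
  refine ⟨.inl 0, ?_⟩
  rintro (i | l)
  · exact hs i
  · exact (hs l.1).trans (Adj.reachable (by simp))

lemma caterpillar_isTree (k : ℕ) (p : ℕ → ℕ) : (caterpillar (k + 1) p).IsTree := by
  refine (caterpillar_connected k p).isTree_of_parent (.inl 0)
    (Sum.elim (fun i => .inl ⟨i.val - 1, by omega⟩) fun l => .inl l.1) ?_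
  rintro (i | l) (j | l') h
  · simp only [caterpillar_adj_inl_inl] at h
    simp only [ne_eq, Sum.inl.injEq, Fin.ext_iff, Sum.elim_inl, Fin.val_zero]
    omega
  · right; simpa using h
  · left; simpa using h
  · simp at h

lemma caterpillar_ncard_neighborSet_inr (l : Σ i : Fin m, Fin (p i)) :
    ((caterpillar m p).neighborSet (.inr l)).ncard = 1 := by
  have : (caterpillar m p).neighborSet (.inr l) = {.inl l.1} := by
    ext (i | l')
    · simp [eq_comm]
    · simp
  rw [this, Set.ncard_singleton]

lemma ncard_neighborSet_ne_one_of_two {G : SimpleGraph V} {u v w : V} (hv : G.Adj u v)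
    (hw : G.Adj u w) (hvw : v ≠ w) : (G.neighborSet u).ncard ≠ 1 := by
  intro h
  obtain ⟨a, ha⟩ := Set.ncard_eq_one.1 h
  have h1 : v ∈ G.neighborSet u := hv
  have h2 : w ∈ G.neighborSet u := hw
  rw [ha] at h1 h2
  exact hvw (h1.trans h2.symm)

/-- Leaves at both ends keep the spine ends from being pendant; a one-vertex spine needs two. -/
lemma caterpillar_ncard_neighborSet_inl {k : ℕ} (h0 : 1 ≤ p 0) (hk : 1 ≤ p k)
    (h0k : k = 0 → 2 ≤ p 0) (i : Fin (k + 1)) :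
    ((caterpillar (k + 1) p).neighborSet (.inl i)).ncard ≠ 1 := by
  obtain ⟨i, hi⟩ := i
  by_cases hi0 : i = 0
  · subst hi0
    by_cases hk0 : k = 0
    · subst hk0
      exact ncard_neighborSet_ne_one_of_two (v := .inr ⟨⟨0, hi⟩, ⟨0, h0⟩⟩)
        (w := .inr ⟨⟨0, hi⟩, ⟨1, h0k rfl⟩⟩) (by simp) (by simp) (by simp)
    · exact ncard_neighborSet_ne_one_of_two (v := .inr ⟨⟨0, hi⟩, ⟨0, h0⟩⟩)
        (w := .inl ⟨1, by omega⟩) (by simp) (by simp) (by simp)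
  · by_cases hik : i = k
    · subst hik
      exact ncard_neighborSet_ne_one_of_two (v := .inr ⟨⟨i, hi⟩, ⟨0, hk⟩⟩)
        (w := .inl ⟨i - 1, by omega⟩) (by simp) (by simp; omega) (by simp)
    · exact ncard_neighborSet_ne_one_of_two (v := .inl ⟨i + 1, by omega⟩)
        (w := .inl ⟨i - 1, by omega⟩) (by simp) (by simp; omega) (by simp; omega)

lemma caterpillar_isCaterpillar {k : ℕ} (h0 : 1 ≤ p 0) (hk : 1 ≤ p k)
    (h0k : k = 0 → 2 ≤ p 0) : (caterpillar (k + 1) p).IsCaterpillar := by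
  refine ⟨caterpillar_isTree k p, k + 1, ⟨Iso.symm ?_⟩⟩
  let f : Fin (k + 1) → {v | ((caterpillar (k + 1) p).neighborSet v).ncard ≠ 1} := fun i =>
    ⟨.inl i, caterpillar_ncard_neighborSet_inl h0 hk h0k i⟩
  have hf : Function.Bijective f := by
    refine ⟨fun i j h => Sum.inl.inj (congrArg Subtype.val h), ?_⟩
    rintro ⟨i | l, hv⟩
    · exact ⟨i, rfl⟩
    · exact absurd (caterpillar_ncard_neighborSet_inr l) hv
  exact
    { toEquiv := Equiv.ofBijective f hf
      map_rel_iff' := Iff.rfl }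

/-- The 2-colouring of a caterpillar by the parity of the distance to the first spine vertex. -/
def caterpillarColoring (m : ℕ) (p : ℕ → ℕ) : (caterpillar m p).Coloring Bool :=
  Coloring.mk (Sum.elim (fun i => decide (i.val % 2 = 0)) fun l => decide (l.1.val % 2 = 1)) <| by
    rintro (i | l) (j | l') h
    · simp only [caterpillar_adj_inl_inl] at h
      simp only [Sum.elim_inl, ne_eq, decide_eq_decide]
      omega
    · simp only [caterpillar_adj_inl_inr] at h
      subst h
      simp only [Sum.elim_inl, Sum.elim_inr, ne_eq, decide_eq_decide]
      omega
    · simp only [caterpillar_adj_inr_inl] at h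
      subst h
      simp only [Sum.elim_inl, Sum.elim_inr, ne_eq, decide_eq_decide]
      omega
    · simp at h

lemma sum_path_neighbors {k : ℕ} (x : ℕ → ℝ) (i : Fin (k + 1)) :
    ∑ j : Fin (k + 1), (if i.val + 1 = j.val ∨ j.val + 1 = i.val then x j else 0) =
      (if i.val = 0 then 0 else x (i - 1)) + if i.val = k then 0 else x (i + 1) := by
  have hi := i.2
  rw [Fin.sum_univ_eq_sum_range
    (fun j => if i.val + 1 = j ∨ j + 1 = i.val then x j else 0) (k + 1)]
  have : ∀ j ∈ Finset.range (k + 1), (if i.val + 1 = j ∨ j + 1 = i.val then x j else 0) =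
      (if j = i.val - 1 then (if i.val = 0 then 0 else x (i - 1)) else 0)
      + if j = i.val + 1 then x (i + 1) else 0 := by
    intro j _
    by_cases h1 : i.val + 1 = j
    · subst h1
      have h2 : ¬ (i.val + 1 = i.val - 1) := by omega
      simp [h2]
    · have h1' : ¬ j = i.val + 1 := fun h => h1 h.symm
      by_cases h2 : j + 1 = i.val
      · have h3 : j = i.val - 1 := by omega
        have h4 : i.val ≠ 0 := by omega
        simp [h2, h1', ← h3, h4]
      · by_cases h3 : i.val = 0
        · rw [if_neg (not_or.2 ⟨h1, h2⟩), if_neg h1', if_pos h3, ite_self, add_zero]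
        · have h4 : ¬ j = i.val - 1 := by omega
          simp [h1, h1', h2, h4]
  rw [Finset.sum_congr rfl this, Finset.sum_add_distrib, Finset.sum_ite_eq', Finset.sum_ite_eq']
  have h1 : i.val - 1 ∈ Finset.range (k + 1) := Finset.mem_range.2 (by omega)
  rw [if_pos h1]
  congr 1
  by_cases h : i.val = k
  · simp [h]
  · have : i.val + 1 ∈ Finset.range (k + 1) := Finset.mem_range.2 (by omega)
    rw [if_pos this, if_neg h]

open Classical in
/-- The adjacency sums of a vector that has entry `x i` at the spine vertex `i` and `y i` at the
pendant vertices attached to `i`. -/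
lemma caterpillar_sum_inl {k : ℕ} (x y : ℕ → ℝ) (i : Fin (k + 1)) :
    ∑ w, (if (caterpillar (k + 1) p).Adj (.inl i) w then
        Sum.elim (fun j : Fin (k + 1) => x j) (fun l => y l.1) w else 0) =
      (if i.val = 0 then 0 else x (i - 1)) + (if i.val = k then 0 else x (i + 1)) + p i * y i := by
  rw [Fintype.sum_sum_type, ← sum_path_neighbors]
  congr 1
  · simp
  · rw [Fintype.sum_sigma, Finset.sum_eq_single i]
    · simp
    · intro j _ hj
      simp [hj]
    · simp

open Classical in
lemma caterpillar_sum_inr {k : ℕ} (x y : ℕ → ℝ) (l : Σ i : Fin (k + 1), Fin (p i)) :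
    ∑ w, (if (caterpillar (k + 1) p).Adj (.inr l) w then
        Sum.elim (fun j : Fin (k + 1) => x j) (fun l => y l.1) w else 0) = x l.1 := by
  simp [Fintype.sum_sum_type]

end caterpillar

end SimpleGraph

/-! ### The greedy vector and its boundedness -/

/-- The number of steps `1 / lam` that bring `s` down into the interval `[t, t + 1 / lam)`. -/
noncomputable def greedyCount (lam t s : ℝ) : ℕ := ⌊(s - t) * lam⌋₊

/-- The ratios of consecutive spine entries of the greedy caterpillar. -/
noncomputable def greedyRatio (lam t : ℝ) : ℕ → ℝ
  | 0 => lam - greedyCount lam t lam / lam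
  | i + 1 => lam - 1 / greedyRatio lam t i
      - greedyCount lam t (lam - 1 / greedyRatio lam t i) / lam

/-- The numbers of pendant vertices of the greedy caterpillar. -/
noncomputable def greedyLeaves (lam t : ℝ) : ℕ → ℕ
  | 0 => greedyCount lam t lam
  | i + 1 => greedyCount lam t (lam - 1 / greedyRatio lam t i)

/-- The spine entries of the greedy vector. -/
noncomputable def greedyVec (lam t : ℝ) : ℕ → ℝ
  | 0 => 1
  | i + 1 => greedyRatio lam t i * greedyVec lam t i

section
variable {lam t : ℝ}

lemma greedyCount_bounds (hl : 0 < lam) {s : ℝ} (hs : t ≤ s) :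
    t ≤ s - greedyCount lam t s / lam ∧ s - greedyCount lam t s / lam < t + 1 / lam := by
  have h0 : 0 ≤ (s - t) * lam := mul_nonneg (by linarith) hl.le
  have h1 := Nat.floor_le h0
  have h2 := Nat.lt_floor_add_one ((s - t) * lam)
  have h3 : (greedyCount lam t s : ℝ) / lam ≤ s - t := (div_le_iff₀ hl).2 h1
  have h4 : s - t < (greedyCount lam t s + 1 : ℝ) / lam := (lt_div_iff₀ hl).2 h2
  rw [add_div] at h4
  constructor <;> linarith

/-- `t` is a fixed point of the increasing map `r ↦ lam - 1 / r`, so no step falls below `t` before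
leaves are added. -/
lemma greedyRatio_bounds (hl : 0 < lam) (ht : 0 < t) (hroot : t ^ 2 + 1 = lam * t) (i : ℕ) :
    t ≤ greedyRatio lam t i ∧ greedyRatio lam t i < t + 1 / lam := by
  induction i with
  | zero =>
    refine greedyCount_bounds hl ?_
    nlinarith
  | succ i ih =>
    refine greedyCount_bounds hl ?_
    have h1 : 1 / greedyRatio lam t i ≤ 1 / t := one_div_le_one_div_of_le ht ih.1
    have h2 : 1 / t = lam - t := by field_simp; linarith
    linarith

lemma greedyLeaves_zero_pos (hl : 0 < lam) (ht : 0 < t) (ht1 : t < 1)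
    (hroot : t ^ 2 + 1 = lam * t) : 1 ≤ greedyLeaves lam t 0 := by
  refine Nat.le_floor ?_
  have : lam - t = 1 / t := by field_simp; linarith
  push_cast
  rw [this, div_mul_eq_mul_div, one_mul, le_div_iff₀ ht]
  nlinarith

lemma greedyVec_pos (hl : 0 < lam) (ht : 0 < t) (hroot : t ^ 2 + 1 = lam * t) (i : ℕ) :
    0 < greedyVec lam t i := by
  induction i with
  | zero => exact one_pos
  | succ i ih => exact mul_pos (ht.trans_le (greedyRatio_bounds hl ht hroot i).1) ih

/-- The eigenvalue equation at spine vertex `i`, for a spine continuing past `i`. -/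
lemma greedyVec_eq (hl : 0 < lam) (ht : 0 < t) (hroot : t ^ 2 + 1 = lam * t) (i : ℕ) :
    lam * greedyVec lam t i = (if i = 0 then 0 else greedyVec lam t (i - 1))
      + greedyVec lam t (i + 1) + greedyLeaves lam t i * (greedyVec lam t i / lam) := by
  cases i with
  | zero => simp only [greedyVec, greedyRatio, greedyLeaves, if_true]; ring
  | succ i =>
    have hr : 0 < greedyRatio lam t i := ht.trans_le (greedyRatio_bounds hl ht hroot i).1
    simp only [greedyVec, greedyRatio, greedyLeaves, Nat.add_sub_cancel, if_neg (Nat.succ_ne_zero i)]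
    field_simp
    ring

/-- The invariant vector field of the step `r ↦ lam - 1 / r` does not grow under the greedy
reduction. -/
lemma greedyRatio_field_le (hl : 0 < lam) (ht : 0 < t) (ht1 : t ^ 4 + t ^ 2 < 1)
    (hroot : t ^ 2 + 1 = lam * t) (i : ℕ) :
    greedyRatio lam t i ^ 2 *
      (lam * greedyRatio lam t (i + 1) - 1 - greedyRatio lam t (i + 1) ^ 2) ≤
    lam * greedyRatio lam t i - 1 - greedyRatio lam t i ^ 2 := by
  obtain ⟨h1, h2⟩ := greedyRatio_bounds hl ht hroot i
  set r := greedyRatio lam t i with hr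
  have hr0 : 0 < r := ht.trans_le h1
  set s := lam - 1 / r with hs
  have hq : lam * r - 1 - r ^ 2 = r ^ 2 * (lam * s - 1 - s ^ 2) := by
    rw [hs]; field_simp; ring
  rw [hq]
  refine mul_le_mul_of_nonneg_left ?_ (sq_nonneg _)
  have hstep : greedyRatio lam t (i + 1) = s - greedyCount lam t s / lam := rfl
  rw [hstep]
  rcases Nat.eq_zero_or_pos (greedyCount lam t s) with h0 | hpos
  · simp [h0]
  · have hp : (1 : ℝ) ≤ greedyCount lam t s := by exact_mod_cast hpos
    set p : ℝ := (greedyCount lam t s : ℝ)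
    have hpl : 1 / lam ≤ p / lam := div_le_div_of_nonneg_right hp hl.le
    have hp0 : 0 ≤ p / lam := by positivity
    have hlam : lam = t + 1 / t := by field_simp; linarith
    -- Lowering `s` by `δ = p / lam` changes the field by `δ (2 s - lam - δ)`; as `δ ≥ 1 / lam`,
    -- this bound makes the change nonpositive.
    have hsb : 2 * s ≤ lam + 1 / lam := by
      have hb : 1 / (t + 1 / lam) ≤ 1 / r := one_div_le_one_div_of_le hr0 h2.le
      have : 2 * (lam - 1 / (t + 1 / lam)) ≤ lam + 1 / lam := by
        have e1 : 1 / (t + 1 / lam) = lam / (t ^ 2 + 2) := by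
          have : t + 1 / lam = (t ^ 2 + 2) / lam := by
            field_simp; linarith
          rw [this, one_div_div]
        have e2 : 1 / lam = t / (t ^ 2 + 1) := by rw [hroot]; field_simp
        have e3 : lam = (t ^ 2 + 1) / t := by rw [hroot]; field_simp
        rw [e1, e2, e3, ← sub_nonneg]
        have : (t ^ 2 + 1) / t + t / (t ^ 2 + 1) - 2 * ((t ^ 2 + 1) / t - (t ^ 2 + 1) / t / (t ^ 2 + 2))
          = (t ^ 2 * (1 - t ^ 2 - t ^ 4)) / (t * (t ^ 2 + 1) * (t ^ 2 + 2)) := by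
          field_simp
          ring
        rw [this]
        have : 0 ≤ 1 - t ^ 2 - t ^ 4 := by linarith
        positivity
      linarith
    nlinarith

lemma greedyVec_sq_mul_field_le (hl : 0 < lam) (ht : 0 < t) (ht1 : t ^ 4 + t ^ 2 < 1)
    (hroot : t ^ 2 + 1 = lam * t) (i : ℕ) :
    greedyVec lam t i ^ 2 * (lam * greedyRatio lam t i - 1 - greedyRatio lam t i ^ 2) ≤
      lam * greedyRatio lam t 0 - 1 - greedyRatio lam t 0 ^ 2 := by
  induction i with
  | zero => simp [greedyVec]
  | succ i ih =>
    refine le_trans ?_ ih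
    have h := mul_le_mul_of_nonneg_left (greedyRatio_field_le hl ht ht1 hroot i)
      (sq_nonneg (greedyVec lam t i))
    calc _ = _ := by simp only [greedyVec]; ring
      _ ≤ _ := h

/-- Keeps the ratios uniformly below the other root `1 / t`, so the field is bounded away from zero
for ratios above `1`. -/
lemma add_one_div_lt (hl : 0 < lam) (ht : 0 < t) (ht1 : t ^ 4 + t ^ 2 < 1)
    (hroot : t ^ 2 + 1 = lam * t) : t + 1 / lam < 1 / t := by
  have e : 1 / t - (t + 1 / lam) = (1 - t ^ 2 - t ^ 4) / (t * (t ^ 2 + 1)) := by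
    rw [show 1 / lam = t / (t ^ 2 + 1) by rw [hroot]; field_simp]
    field_simp
    ring
  have : 0 < (1 - t ^ 2 - t ^ 4) / (t * (t ^ 2 + 1)) := by
    have : 0 < 1 - t ^ 2 - t ^ 4 := by linarith
    positivity
  linarith

lemma exists_greedyVec_sq_le (hl : 0 < lam) (ht : 0 < t) (ht1 : t ^ 4 + t ^ 2 < 1)
    (hroot : t ^ 2 + 1 = lam * t) :
    ∃ B, ∀ i, greedyVec lam t i ^ 2 ≤ B := by
  have hlt1 : t < 1 := by
    by_contra! h
    nlinarith [pow_pos ht 4]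
  have hgap := add_one_div_lt hl ht ht1 hroot
  set κ := 1 / t - (t + 1 / lam) with hκ
  have hκ0 : 0 < κ := by linarith
  set C := lam * greedyRatio lam t 0 - 1 - greedyRatio lam t 0 ^ 2 with hC
  set B := max 1 (C / (κ * (1 - t))) with hB
  have hd : 0 < κ * (1 - t) := mul_pos hκ0 (by linarith)
  have hti : 1 < 1 / t := by rw [lt_div_iff₀ ht]; linarith
  -- Below `B` one step gains at most a factor `(1 / t) ^ 2`; above `B` the field bound forces `r ≤
  -- 1`, hence no growth.
  refine ⟨B * (1 / t) ^ 2, fun i => ?_⟩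
  have hB1 : 1 ≤ B := le_max_left _ _
  induction i with
  | zero => simp only [greedyVec]; nlinarith
  | succ i ih =>
    obtain ⟨h1, h2⟩ := greedyRatio_bounds hl ht hroot i
    have hx := greedyVec_sq_mul_field_le hl ht ht1 hroot i
    rw [← hC] at hx
    set r := greedyRatio lam t i
    set x := greedyVec lam t i
    have hstep : greedyVec lam t (i + 1) = r * x := rfl
    rw [hstep, mul_pow]
    have hr0 : 0 < r := ht.trans_le h1
    by_cases hxB : x ^ 2 ≤ B
    · have : r ^ 2 ≤ (1 / t) ^ 2 := pow_le_pow_left₀ hr0.le (by linarith) 2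
      nlinarith [sq_nonneg x]
    · push Not at hxB
      have hr1 : r ≤ 1 := by
        by_contra! hr1
        have hq : κ * (1 - t) ≤ lam * r - 1 - r ^ 2 := by
          have : lam * r - 1 - r ^ 2 = (1 / t - r) * (r - t) := by
            have : lam = t + 1 / t := by field_simp; linarith
            rw [this]; field_simp; ring
          rw [this]
          exact mul_le_mul (by linarith) (by linarith) (by linarith) (by linarith)
        have h3 : x ^ 2 * (κ * (1 - t)) ≤ C :=
          (mul_le_mul_of_nonneg_left hq (sq_nonneg x)).trans hx
        have h4 : x ^ 2 ≤ C / (κ * (1 - t)) := (le_div_iff₀ hd).2 h3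
        exact absurd (h4.trans (le_max_right _ _)) (not_le.2 hxB)
      nlinarith [sq_nonneg x, mul_le_one₀ hr1 hr0.le hr1]

/-- Otherwise every square is at least `ε`, since the sum contains `x 0 ^ 2 = 1`; the sums then
diverge, and so would the squares. -/
lemma exists_greedyVec_sq_le_mul_sum (hl : 0 < lam) (ht : 0 < t) (ht1 : t ^ 4 + t ^ 2 < 1)
    (hroot : t ^ 2 + 1 = lam * t) {ε : ℝ} (hε : 0 < ε) :
    ∃ k, greedyVec lam t k ^ 2 ≤ ε * ∑ i ∈ Finset.range (k + 1), greedyVec lam t i ^ 2 := by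
  obtain ⟨B, hB⟩ := exists_greedyVec_sq_le hl ht ht1 hroot
  by_contra! hcon
  have hS : ∀ k, 1 ≤ ∑ i ∈ Finset.range (k + 1), greedyVec lam t i ^ 2 := fun k => by
    have := Finset.single_le_sum (f := fun i => greedyVec lam t i ^ 2)
      (fun i _ => sq_nonneg _) (Finset.mem_range.2 (Nat.succ_pos k))
    simpa [greedyVec] using this
  have hx : ∀ k, ε ≤ greedyVec lam t k ^ 2 := fun k => by
    nlinarith [hcon k, hS k]
  obtain ⟨k, hk⟩ := exists_nat_gt (B / (ε * ε))
  have h1 : (k + 1 : ℕ) * ε ≤ ∑ i ∈ Finset.range (k + 1), greedyVec lam t i ^ 2 := by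
    have := Finset.card_nsmul_le_sum (Finset.range (k + 1)) (fun i => greedyVec lam t i ^ 2) ε
      (fun i _ => hx i)
    simpa using this
  rw [div_lt_iff₀ (mul_pos hε hε)] at hk
  push_cast at h1
  nlinarith [hcon k, hB k, mul_le_mul_of_nonneg_left h1 hε.le, mul_pos hε hε]

end

/-! ### Approximation from below and the limit -/

lemma exists_small_root {lam : ℝ} (h : √(2 + √5) < lam) :
    ∃ t : ℝ, 0 < t ∧ t ^ 4 + t ^ 2 < 1 ∧ t ^ 2 + 1 = lam * t := by
  have h5 : 0 < √(5 : ℝ) := by positivity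
  have h55 : √(5 : ℝ) ^ 2 = 5 := Real.sq_sqrt (by norm_num)
  have hl : 0 < lam := lt_of_le_of_lt (Real.sqrt_nonneg _) h
  have hl2 : 2 + √5 < lam ^ 2 := (Real.sqrt_lt' hl).1 h
  have h52 : 2 < √(5 : ℝ) := by nlinarith
  have hD : √(lam ^ 2 - 4) ^ 2 = lam ^ 2 - 4 := Real.sq_sqrt (by linarith)
  have hD0 : 0 < √(lam ^ 2 - 4) := Real.sqrt_pos.2 (by linarith)
  set D := √(lam ^ 2 - 4)
  have hDl : D < lam := by nlinarith
  have hroot : ((lam - D) / 2) ^ 2 + 1 = lam * ((lam - D) / 2) := by nlinarith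
  refine ⟨(lam - D) / 2, by linarith, ?_, hroot⟩
  set t := (lam - D) / 2 with ht
  -- As `lam = 1 / t + t` and `D = 1 / t - t`, this says `1 / t² - t² > 1`, i.e. `t⁴ + t² < 1`.
  have hlD : 1 < lam * D := by
    have : 1 < (lam * D) ^ 2 := by rw [mul_pow, hD]; nlinarith
    nlinarith [mul_pos hl hD0]
  have hDe : D = lam - 2 * t := by rw [ht]; ring
  have htp : 0 < t := by rw [ht]; linarith
  have h2 : lam * t * (lam * t) - 2 * (lam * t) * t ^ 2 - t ^ 2 > 0 := by
    rw [hDe] at hlD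
    nlinarith [mul_pos htp htp]
  rw [← hroot] at h2
  nlinarith

lemma SimpleGraph.sum_adj_comap {V W : Type*} [Fintype V] [Fintype W] (e : V ≃ W)
    (G : SimpleGraph W)
    [DecidableRel G.Adj] [DecidableRel (G.comap e).Adj] (x : W → ℝ) (v : V) :
    ∑ w, (if (G.comap e).Adj v w then x (e w) else 0) =
      ∑ w, (if G.Adj (e v) w then x w else 0) := by
  rw [← e.sum_comp]
  simp

open SimpleGraph OrientedGraph in
/-- Every `lam > √(2 + √5)` is approximated from below by skew spectral radii of oriented
caterpillars. -/
lemma exists_caterpillar_skewSpectralRadius_near {lam ε : ℝ} (h : √(2 + √5) < lam) (hε : 0 < ε) :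
    ∃ (n : ℕ) (T : OrientedGraph (Fin n)), T.graph.IsCaterpillar ∧
      lam - ε ≤ T.skewSpectralRadius ∧ T.skewSpectralRadius ≤ lam := by
  classical
  obtain ⟨t, ht, ht4, hroot⟩ := exists_small_root h
  have hl : 0 < lam := lt_of_le_of_lt (Real.sqrt_nonneg _) h
  have ht1 : t < 1 := by
    by_contra! h
    nlinarith [pow_pos ht 4]
  obtain ⟨k, hk⟩ := exists_greedyVec_sq_le_mul_sum hl ht ht4 hroot (mul_pos hε ht)
  set x := greedyVec lam t with hx
  set r := greedyRatio lam t k with hr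
  have hxp : ∀ i, 0 < x i := greedyVec_pos hl ht hroot
  obtain ⟨hr1, hr2⟩ := greedyRatio_bounds hl ht hroot k
  rw [← hr] at hr1 hr2
  have hgap := add_one_div_lt hl ht ht4 hroot
  have hlt : 1 / lam ≤ t := (div_le_iff₀ hl).2 (by nlinarith)
  have hl0 : 0 < 1 / lam := by positivity
  -- The extra leaf at `k` stands in for the missing neighbour `k + 1`: it supplies `x k / lam`
  -- instead of `r * x k`, leaving the deficit `d ≥ 0`. It also keeps the last spine vertex from
  -- being pendant.
  let p : ℕ → ℕ := fun i => greedyLeaves lam t i + if i = k then 1 else 0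
  have hg0 := greedyLeaves_zero_pos hl ht ht1 hroot
  have hcat : (caterpillar (k + 1) p).IsCaterpillar := by
    refine caterpillar_isCaterpillar ?_ ?_ ?_
    · exact le_add_right hg0
    · simp [p]
    · rintro rfl
      simp only [p, if_true]
      omega
  let z : (Fin (k + 1) ⊕ Σ i : Fin (k + 1), Fin (p i)) → ℝ :=
    Sum.elim (fun j => x j) (fun l => x l.1 / lam)
  let last : Fin (k + 1) ⊕ Σ i : Fin (k + 1), Fin (p i) := .inl (Fin.last k)
  set d := x k * (r - 1 / lam) with hd
  have hd0 : 0 ≤ d := mul_nonneg (hxp k).le (by linarith)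
  have hz : ∀ v, ∑ w, (if (caterpillar (k + 1) p).Adj v w then z w else 0) =
      lam * z v - if v = last then d else 0 := by
    rintro (i | l)
    · refine (caterpillar_sum_inl x (fun i => x i / lam) i).trans ?_
      have heq := greedyVec_eq hl ht hroot i
      rw [← hx] at heq
      by_cases hik : i.val = k
      · have hi : i = Fin.last k := Fin.ext hik
        have hstep : x (k + 1) = r * x k := rfl
        rw [hik, hstep] at heq
        simp only [hi, last, z, p, d, if_true, Fin.val_last, Sum.elim_inl, heq]
        push_cast
        ring
      · have hi : i ≠ Fin.last k := fun h => hik (by simp [h])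
        simp only [last, z, p, Sum.inl.injEq, hi, hik, if_false, Sum.elim_inl, heq]
        push_cast
        ring
    · refine (caterpillar_sum_inr x (fun i => x i / lam) l).trans ?_
      simp only [last, z, Sum.elim_inr, reduceCtorEq, if_false]
      field_simp
      ring
  have hzpos : ∀ v, 0 < z v := by
    rintro (i | l)
    · exact hxp i
    · exact div_pos (hxp _) hl
  have hsum : ∑ i ∈ Finset.range (k + 1), x i ^ 2 ≤ ∑ v, z v ^ 2 := by
    rw [Fintype.sum_sum_type, ← Fin.sum_univ_eq_sum_range (fun i => x i ^ 2)]
    exact le_add_of_nonneg_right (Finset.sum_nonneg fun _ _ => sq_nonneg _)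
  have hquad : ∑ v, z v * ∑ w, (if (caterpillar (k + 1) p).Adj v w then z w else 0) =
      lam * ∑ v, z v ^ 2 - x k * d := by
    simp only [hz, mul_sub, Finset.sum_sub_distrib, mul_ite, mul_zero, Finset.mul_sum]
    rw [Finset.sum_ite_eq' Finset.univ last]
    congr 1
    · exact Finset.sum_congr rfl fun v _ => by ring
    · simp [last, z]
  have hxd : x k * d ≤ ε * ∑ v, z v ^ 2 := by
    have hrt : r - 1 / lam ≤ 1 / t := by linarith
    calc x k * d = x k ^ 2 * (r - 1 / lam) := by rw [hd]; ring
      _ ≤ x k ^ 2 * (1 / t) := mul_le_mul_of_nonneg_left hrt (sq_nonneg _)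
      _ ≤ (ε * t * ∑ v, z v ^ 2) * (1 / t) :=
        mul_le_mul_of_nonneg_right
          (hk.trans (mul_le_mul_of_nonneg_left hsum (mul_pos hε ht).le)) (by positivity)
      _ = ε * ∑ v, z v ^ 2 := by field_simp
  let e := (Fintype.equivFin (Fin (k + 1) ⊕ Σ i : Fin (k + 1), Fin (p i))).symm
  let c : ((caterpillar (k + 1) p).comap e).Coloring Bool :=
    (caterpillarColoring (k + 1) p).comp (Iso.comap e (caterpillar (k + 1) p)).toHom
  refine ⟨_, ofColoring _ c, hcat.of_iso (Iso.comap e _), ?_, ?_⟩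
  · have hsq : ∑ v, z (e v) ^ 2 = ∑ v, z v ^ 2 := e.sum_comp fun v => z v ^ 2
    refine le_skewSpectralRadius_ofColoring _ c (fun v => z (e v)) ?_ ?_
    · exact Finset.sum_pos (fun v _ => pow_pos (hzpos _) 2) ⟨e.symm last, Finset.mem_univ _⟩
    · rw [hsq]
      refine le_of_le_of_eq (b := lam * ∑ v, z v ^ 2 - x k * d) (by linarith) (hquad.symm.trans ?_)
      rw [← e.sum_comp]
      exact Finset.sum_congr rfl fun v _ =>
        congrArg (z (e v) * ·) (sum_adj_comap e (caterpillar (k + 1) p) z v).symm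
  · refine skewSpectralRadius_le _ hl.le (fun v => z (e v)) (fun v => hzpos _) fun v => ?_
    refine (sum_adj_comap e (caterpillar (k + 1) p) z v).le.trans ?_
    rw [hz]
    split_ifs <;> linarith

theorem mainTheorem8 (lam : ℝ) (hlam : √(2 + √5) ≤ lam) :
    ∃ (n : ℕ → ℕ) (T : ∀ k : ℕ, OrientedGraph (Fin (n k))),
      (∀ k, (T k).graph.IsCaterpillar) ∧
      (∀ i j, i ≠ j → (T i).skewSpectralRadius ≠ (T j).skewSpectralRadius) ∧
      Tendsto (fun k => (T k).skewSpectralRadius) atTop (𝓝 lam) := by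
  let R : Set ℝ := {ρ | lam < ρ ∧ ∃ (n : ℕ) (T : OrientedGraph (Fin n)),
    T.graph.IsCaterpillar ∧ T.skewSpectralRadius = ρ}
  have hR : ∀ b, lam < b → ∃ ρ ∈ R, ρ < b := fun b hb => by
    -- Aiming at the midpoint of `lam` and `b` with error a quarter of the gap lands strictly
    -- between them.
    obtain ⟨n, T, hT, h1, h2⟩ := exists_caterpillar_skewSpectralRadius_near
      (lam := lam + (b - lam) / 2) (ε := (b - lam) / 4) (by linarith) (by linarith)
    exact ⟨T.skewSpectralRadius, ⟨by linarith, n, T, hT, rfl⟩, by linarith⟩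
  have hglb : IsGLB R lam := by
    refine ⟨fun ρ hρ => hρ.1.le, fun b hb => ?_⟩
    by_contra! hlt
    obtain ⟨ρ, hρ, hρb⟩ := hR b hlt
    exact absurd (hb hρ) (not_le.2 hρb)
  obtain ⟨ρ₀, hρ₀, -⟩ := hR (lam + 1) (by linarith)
  obtain ⟨u, hu, -, hlim, hmem⟩ :=
    hglb.exists_seq_strictAnti_tendsto_of_notMem (fun hmem => lt_irrefl _ hmem.1) ⟨ρ₀, hρ₀⟩
  choose n T hT hTu using fun k => (hmem k).2
  refine ⟨n, T, hT, fun i j hij => ?_, ?_⟩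
  · rw [hTu, hTu]
    exact hu.injective.ne hij
  · simpa only [hTu] using hlim
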